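/- Let $\mathbb{X}\subset\mathbb{R}^d$ be nonempty and compact, and let $f$ be an $m$-output Gaussian process on $\mathbb{X}$ (a Gaussian process on $\mathbb{X}\times\{1,\dots,m\}$) whose prior mean and covariance functions are continuously differentiable on $\mathbb{X}$ and $\mathbb{X}\times\mathbb{X}$. Let $\mathcal{D}=\{(x_k,y_k)\}_{k=1}^n$ be data with $x_k\in\mathbb{X}$ and $y_k\in\mathbb{R}^m$, observed under centered Gaussian noise with (possibly zero) covariance matrix $R$, such that the prior covariance matrix of all the observations, $K(x_{\mathcal D},x_{\mathcal D})+R$, is invertible. For $\mathbf{x}=(x_1,\dots,x_q)\in\mathbb{X}^q$ let $$\mu_{\mathcal{D}}(\mathbf{x})=\mu(\mathbf{x})+K(\mathbf{x},x_{\mathcal D})\,(K(x_{\mathcal D},x_{\mathcal D})+R)^{-1}(y-\mu(x_{\mathcal D})),$$ $$\Sigma_{\mathcal{D}}(\mathbf{x})=K(\mathbf{x},\mathbf{x})-K(\mathbf{x},x_{\mathcal D})\,(K(x_{\mathcal D},x_{\mathcal D})+R)^{-1}K(x_{\mathcal D},\mathbf{x})$$ be the mean and the covariance of the posterior law $\mathcal{N}(\mu_{\mathcal{D}}(\mathbf{x}),\Sigma_{\mathcal{D}}(\mathbf{x}))$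 of $f(\mathbf{x})\in\mathbb{R}^{q\times m}$. Let $L(\mathbf{x})$ be any square matrices with $L(\mathbf{x})L(\mathbf{x})^T=\Sigma_{\mathcal{D}}(\mathbf{x})$ for all $\mathbf{x}\in\mathbb{X}^q$ (for instance Cholesky factors). Let $g:\mathbb{R}^{q\times m}\to\mathbb{R}^q$ and $a(\cdot,\Phi):\mathbb{R}^q\to\mathbb{R}$ be Lipschitz continuous, and let $\epsilon^1,\epsilon^2,\dots$ be i.i.d. standard normal vectors in $\mathbb{R}^{q\times m}$. Define on $\mathbb{X}^q$ $$\alpha(\mathbf{x})=\mathbb{E}\bigl[a(g(f(\mathbf{x})),\Phi)\mid\mathcal{D}\bigr],\qquad \hat\alpha_N(\mathbf{x})=\frac1N\sum_{i=1}^N a\bigl(g(\mu_{\mathcal{D}}(\mathbf{x})+L(\mathbf{x})\epsilon^i),\Phi\bigr),$$ where the expectation defining $\alpha$ is with respect to the posterior law, and put $\alpha^*=\sup_{\mathbb{X}^q}\alpha$, $\hat\alpha_N^*=\sup_{\mathbb{X}^q}\hat\alpha_N$ and $\mathcal{X}^*=\operatorname{argmax}_{\mathbb{X}^q}\alpha$.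 Then $\alpha$ is well defined, $\mathcal{X}^*\neq\emptyset$, $\hat\alpha_N$ is bounded above on $\mathbb{X}^q$ (and attains its maximum if $L$ is continuous), and: (1) $\hat\alpha_N^*\to\alpha^*$ almost surely as $N\to\infty$. (2) Almost surely, $\operatorname{dist}(\hat{\mathbf{x}}_N^*,\mathcal{X}^*)\to0$ as $N\to\infty$ for every sequence of maximizers $\hat{\mathbf{x}}_N^*\in\operatorname{argmax}_{\mathbb{X}^q}\hat\alpha_N$ $(N\ge1)$. (3) For every $\delta>0$ there are $K<\infty$ and $\beta>0$ such that for all $N\ge1$, the probability that some $\hat{\mathbf{x}}_N^*\in\operatorname{argmax}_{\mathbb{X}^q}\hat\alpha_N$ has $\operatorname{dist}(\hat{\mathbf{x}}_N^*,\mathcal{X}^*)>\delta$ is at most $Ke^{-\beta N}$; in particular $\mathbb{P}\bigl(\operatorname{dist}(\hat{\mathbf{x}}_N^*,\mathcal{X}^*)>\delta\bigr)\le Ke^{-\beta N}$ for any choice of the maximizer. (No separate moment-generating-function condition is imposed for this claim. In probability statements about sets of outcomes that need not be measurable, $\mathbb{P}$ denotes the outer measure.) -/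

import Mathlib

open MeasureTheory ProbabilityTheory Filter Topology

noncomputable section

/-- Candidate sets `(x_1, …, x_q)` of `q` points of `ℝ^d`, with the Euclidean norm of `ℝ^(qd)`. -/
abbrev Cand (d q : ℕ) : Type := PiLp 2 (fun _ : Fin q => EuclideanSpace ℝ (Fin d))

/-- The feasible candidate sets `𝕏^q`. -/
def candSet {d : ℕ} (X : Set (EuclideanSpace ℝ (Fin d))) (q : ℕ) : Set (Cand d q) :=
  {x | ∀ k, x k ∈ X}

/-- The set of maximizers of `F` over `S`. -/
def maximizers {T : Type*} (F : T → ℝ) (S : Set T) : Set T :=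
  {x | x ∈ S ∧ IsMaxOn F S x}

section Model

variable {Ω₀ : Type*} [MeasurableSpace Ω₀] {d m n q : ℕ}

/-- Prior mean function of the `i`-th output of the random function `f`. -/
def priorMean (f : EuclideanSpace ℝ (Fin d) → Fin m → Ω₀ → ℝ) (P₀ : Measure Ω₀)
    (x : EuclideanSpace ℝ (Fin d)) (i : Fin m) : ℝ :=
  ∫ w, f x i w ∂P₀

/-- Prior covariance function between the outputs `i` (at `x`) and `j` (at `y`) of `f`. -/
def priorCov (f : EuclideanSpace ℝ (Fin d) → Fin m → Ω₀ → ℝ) (P₀ : Measure Ω₀)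
    (x : EuclideanSpace ℝ (Fin d)) (i : Fin m) (y : EuclideanSpace ℝ (Fin d)) (j : Fin m) : ℝ :=
  cov[f x i, f y j; P₀]

/-- `f` is an `m`-output Gaussian process on `X` (i.e. a Gaussian process on `X × {1, …, m}`) with
continuously differentiable mean and covariance functions. Values of `f` off `X` play no role. -/
structure IsC1GPPrior (X : Set (EuclideanSpace ℝ (Fin d)))
    (f : EuclideanSpace ℝ (Fin d) → Fin m → Ω₀ → ℝ) (P₀ : Measure Ω₀) : Prop where
  isGaussianProcess : IsGaussianProcess (fun p : X × Fin m => f p.1 p.2) P₀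
  contDiffOn_mean : ∀ i, ContDiffOn ℝ 1 (fun x => priorMean f P₀ x i) X
  contDiffOn_cov : ∀ i j, ContDiffOn ℝ 1
    (fun p : EuclideanSpace ℝ (Fin d) × EuclideanSpace ℝ (Fin d) => priorCov f P₀ p.1 i p.2 j)
    (X ×ˢ X)

/-- Data `{(x_k, y_k)}` of `n` observations `y_k ∈ ℝ^m` at points `x_k`, together with the
covariance matrix of the centred Gaussian observation noise (`0` for noiseless observations,
`σ² I` for i.i.d. noise, any diagonal matrix for heteroskedastic noise). -/
structure Dataset (d m n : ℕ) where
  pt : Fin n → EuclideanSpace ℝ (Fin d)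
  obs : Fin n × Fin m → ℝ
  noiseCov : Matrix (Fin n × Fin m) (Fin n × Fin m) ℝ

/-- Prior covariance matrix of the vector of all observations: `K(x_D, x_D) + noise`. -/
def obsCov (f : EuclideanSpace ℝ (Fin d) → Fin m → Ω₀ → ℝ) (P₀ : Measure Ω₀)
    (D : Dataset d m n) : Matrix (Fin n × Fin m) (Fin n × Fin m) ℝ :=
  Matrix.of (fun p r => priorCov f P₀ (D.pt p.1) p.2 (D.pt r.1) r.2) + D.noiseCov

/-- Prior cross-covariance matrix `K(𝐱, x_D)` between `f(𝐱)` and the observations. -/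
def crossCov (f : EuclideanSpace ℝ (Fin d) → Fin m → Ω₀ → ℝ) (P₀ : Measure Ω₀)
    (D : Dataset d m n) (x : Cand d q) : Matrix (Fin q × Fin m) (Fin n × Fin m) ℝ :=
  Matrix.of (fun p r => priorCov f P₀ (x p.1) p.2 (D.pt r.1) r.2)

/-- Posterior mean `μ_D(𝐱) = μ(𝐱) + K(𝐱, x_D) (K(x_D, x_D) + noise)⁻¹ (y - μ(x_D))`. -/
def postMean (f : EuclideanSpace ℝ (Fin d) → Fin m → Ω₀ → ℝ) (P₀ : Measure Ω₀)
    (D : Dataset d m n) (x : Cand d q) : EuclideanSpace ℝ (Fin q × Fin m) :=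
  WithLp.toLp 2 (fun p => priorMean f P₀ (x p.1) p.2 +
    (crossCov f P₀ D x * (obsCov f P₀ D)⁻¹).mulVec
      (fun r => D.obs r - priorMean f P₀ (D.pt r.1) r.2) p)

/-- Posterior covariance
`K_D(𝐱) = K(𝐱, 𝐱) - K(𝐱, x_D) (K(x_D, x_D) + noise)⁻¹ K(x_D, 𝐱)`. -/
def postCov (f : EuclideanSpace ℝ (Fin d) → Fin m → Ω₀ → ℝ) (P₀ : Measure Ω₀)
    (D : Dataset d m n) (x : Cand d q) : Matrix (Fin q × Fin m) (Fin q × Fin m) ℝ :=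
  Matrix.of (fun p r => priorCov f P₀ (x p.1) p.2 (x r.1) r.2) -
    crossCov f P₀ D x * (obsCov f P₀ D)⁻¹ * (crossCov f P₀ D x).transpose

/-- The posterior law of `f(𝐱) = (f(x_1), …, f(x_q)) ∈ ℝ^(q × m)` given the data. -/
def postLaw (f : EuclideanSpace ℝ (Fin d) → Fin m → Ω₀ → ℝ) (P₀ : Measure Ω₀)
    (D : Dataset d m n) (x : Cand d q) : Measure (EuclideanSpace ℝ (Fin q × Fin m)) :=
  multivariateGaussian (postMean f P₀ D x) (postCov f P₀ D x)

/-- The acquisition function `α(𝐱) = E[u(f(𝐱)) | D]`, where `u = a(g(·), Φ)`. -/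
def acq (f : EuclideanSpace ℝ (Fin d) → Fin m → Ω₀ → ℝ) (P₀ : Measure Ω₀)
    (D : Dataset d m n) (u : EuclideanSpace ℝ (Fin q × Fin m) → ℝ) (x : Cand d q) : ℝ :=
  ∫ z, u z ∂(postLaw f P₀ D x)

/-- The reparameterization `h_D(𝐱, e) = μ_D(𝐱) + L(𝐱) e` of the posterior. -/
def reparam (f : EuclideanSpace ℝ (Fin d) → Fin m → Ω₀ → ℝ) (P₀ : Measure Ω₀)
    (D : Dataset d m n) (L : Cand d q → Matrix (Fin q × Fin m) (Fin q × Fin m) ℝ)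
    (x : Cand d q) (e : EuclideanSpace ℝ (Fin q × Fin m)) : EuclideanSpace ℝ (Fin q × Fin m) :=
  postMean f P₀ D x + Matrix.toEuclideanCLM (𝕜 := ℝ) (L x) e

/-- The sample average approximation `α̂_N(𝐱) = N⁻¹ ∑_{i < N} u(h_D(𝐱, e_i))` for the base
samples `e_0, e_1, …`, where `u = a(g(·), Φ)`. -/
def saa (f : EuclideanSpace ℝ (Fin d) → Fin m → Ω₀ → ℝ) (P₀ : Measure Ω₀)
    (D : Dataset d m n) (L : Cand d q → Matrix (Fin q × Fin m) (Fin q × Fin m) ℝ)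
    (u : EuclideanSpace ℝ (Fin q × Fin m) → ℝ) (e : ℕ → EuclideanSpace ℝ (Fin q × Fin m))
    (N : ℕ) (x : Cand d q) : ℝ :=
  (N : ℝ)⁻¹ * ∑ i ∈ Finset.range N, u (reparam f P₀ D L x (e i))

end Model

end

/-!
Writing the posterior as `c + A e` with `e` standard normal, the sampled utility `u (c + A e)` is
Lipschitz in the parameter `θ = (c, A)` with constant a multiple of `1 + ‖e‖`, which has exponential
moments by Fernique's theorem. Chernoff's bound at the points of a finite net then makes the sample
means converge to the expectation, uniformly over bounded sets of parameters and up to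
exponentially small probabilities. The root `L` may be discontinuous, so it is never used as a
function of the candidate: `‖L(x)‖² = ‖L(x) L(x)ᵀ‖` keeps the parameters `(μ(x), L(x))` in a bounded
set, and this is all that the uniform bound needs. Continuity of `α` comes instead from the positive
semidefinite square root of the covariance, which depends continuously on it. The rest is
deterministic: uniform closeness of `α̂_N` to `α` controls the maximal values, and the gap between
the maximum of `α` and its values away from the maximizers controls the maximizers of `α̂_N`.
-/

lemma tendstoUniformlyOn_iff_forall_abs_sub_le {κ T : Type*} {l : Filter κ} {F : κ → T → ℝ}
    {α : T → ℝ} {S : Set T} :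
    TendstoUniformlyOn F α l S ↔ ∀ τ : ℝ, 0 < τ → ∀ᶠ N in l, ∀ x ∈ S, |F N x - α x| ≤ τ := by
  simp only [Metric.tendstoUniformlyOn_iff, dist_comm (α _), Real.dist_eq]
  refine ⟨fun h τ hτ => ?_, fun h τ hτ => ?_⟩
  · filter_upwards [h τ hτ] with N hN x hx
    exact (hN x hx).le
  · filter_upwards [h (τ / 2) (half_pos hτ)] with N hN x hx
    exact (hN x hx).trans_lt (half_lt_self hτ)

section ExponentialDecay

variable {Ω : Type*} [MeasurableSpace Ω] {P : Measure Ω} {s t : ℕ → Set Ω}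

/-- Events of exponentially small outer probability, the large-deviation notion of a negligible
sequence. The index `0` is left out because averages over an empty sample carry no information. -/
def ExpUnlikely (P : Measure Ω) (s : ℕ → Set Ω) : Prop :=
  ∃ K β : ℝ, 0 < β ∧ ∀ N : ℕ, 1 ≤ N → P (s N) ≤ ENNReal.ofReal (K * Real.exp (-β * N))

namespace ExpUnlikely

lemma mono (ht : ExpUnlikely P t) (hst : ∀ N, 1 ≤ N → s N ⊆ t N) : ExpUnlikely P s :=
  let ⟨K, β, hβ, hK⟩ := ht
  ⟨K, β, hβ, fun N hN => (measure_mono (hst N hN)).trans (hK N hN)⟩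

lemma empty : ExpUnlikely P fun _ => ∅ :=
  ⟨0, 1, one_pos, by simp⟩

lemma union (hs : ExpUnlikely P s) (ht : ExpUnlikely P t) :
    ExpUnlikely P fun N => s N ∪ t N := by
  obtain ⟨K, β, hβ, hK⟩ := hs
  obtain ⟨K', β', hβ', hK'⟩ := ht
  refine ⟨|K| + |K'|, min β β', lt_min hβ hβ', fun N hN => (measure_union_le _ _).trans ?_⟩
  rw [add_mul, ENNReal.ofReal_add (by positivity) (by positivity)]
  gcongr
  · exact (hK N hN).trans (by gcongr; exacts [le_abs_self K, min_le_left _ _])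
  · exact (hK' N hN).trans (by gcongr; exacts [le_abs_self K', min_le_right _ _])

lemma biUnion {κ : Type*} {T : Set κ} (hT : T.Finite) {s : κ → ℕ → Set Ω}
    (hs : ∀ i ∈ T, ExpUnlikely P (s i)) : ExpUnlikely P fun N => ⋃ i ∈ T, s i N := by
  induction T, hT using Set.Finite.induction_on with
  | empty => simpa using empty
  | insert _ _ ih =>
    simp only [Set.biUnion_insert]
    exact (hs _ (Set.mem_insert _ _)).union (ih fun i hi => hs i (Set.mem_insert_of_mem _ hi))

lemma ae_eventually_notMem (hs : ExpUnlikely P s) : ∀ᵐ ω ∂P, ∀ᶠ N in atTop, ω ∉ s N := by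
  obtain ⟨K, β, hβ, hK⟩ := hs
  have hsummable : Summable fun N : ℕ => K * Real.exp (-β * N) := by
    simpa only [mul_comm] using (Real.summable_exp_nat_mul_iff.mpr (neg_neg_of_pos hβ)).mul_left K
  have hsum : ∑' N, P (s (N + 1)) ≠ ⊤ :=
    ne_top_of_le_ne_top ((summable_nat_add_iff 1).mpr hsummable).tsum_ofReal_ne_top
      (ENNReal.tsum_le_tsum fun N => hK (N + 1) N.succ_pos)
  filter_upwards [MeasureTheory.ae_eventually_notMem hsum] with ω hω
  rwa [← Filter.map_add_atTop_eq_nat 1, Filter.eventually_map]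

end ExpUnlikely

/-- The random functions `F N` converge to `α` uniformly on `S`, with exponentially small
probabilities of a large deviation. -/
def ExpTendstoUniformlyOn {T : Type*} (P : Measure Ω) (F : ℕ → Ω → T → ℝ) (α : T → ℝ)
    (S : Set T) : Prop :=
  ∀ τ : ℝ, 0 < τ → ExpUnlikely P fun N => {ω | ∃ x ∈ S, τ < |F N ω x - α x|}

lemma ExpTendstoUniformlyOn.ae_tendstoUniformlyOn {T : Type*} {F : ℕ → Ω → T → ℝ} {α : T → ℝ}
    {S : Set T} (h : ExpTendstoUniformlyOn P F α S) :
    ∀ᵐ ω ∂P, TendstoUniformlyOn (fun N => F N ω) α atTop S := by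
  have hae : ∀ k : ℕ, ∀ᵐ ω ∂P, ∀ᶠ N in atTop, ∀ x ∈ S, |F N ω x - α x| ≤ 1 / ((k : ℝ) + 1) :=
    fun k => by simpa using (h (1 / ((k : ℝ) + 1)) (by positivity)).ae_eventually_notMem
  filter_upwards [ae_all_iff.mpr hae] with ω hω
  refine tendstoUniformlyOn_iff_forall_abs_sub_le.mpr fun τ hτ => ?_
  obtain ⟨k, hk⟩ := exists_nat_one_div_lt hτ
  filter_upwards [hω k] with N hN x hx
  exact (hN x hx).trans hk.le

end ExponentialDecay

section Argmax

variable {T : Type*} {S : Set T} {F α : T → ℝ}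

lemma abs_sSup_image_sub_le (hne : S.Nonempty) (hα : BddAbove (α '' S)) {τ : ℝ}
    (h : ∀ x ∈ S, |F x - α x| ≤ τ) : |sSup (F '' S) - sSup (α '' S)| ≤ τ := by
  have hle : ∀ x ∈ S, F x ≤ sSup (α '' S) + τ := fun x hx => by
    linarith [(abs_le.mp (h x hx)).2, le_csSup hα (Set.mem_image_of_mem α hx)]
  have hF : BddAbove (F '' S) := ⟨_, Set.forall_mem_image.mpr hle⟩
  have hge : ∀ x ∈ S, α x ≤ sSup (F '' S) + τ := fun x hx => by
    linarith [(abs_le.mp (h x hx)).1, le_csSup hF (Set.mem_image_of_mem F hx)]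
  rw [abs_sub_le_iff, sub_le_iff_le_add', sub_le_iff_le_add']
  exact ⟨csSup_le (hne.image F) (Set.forall_mem_image.mpr hle),
    csSup_le (hne.image α) (Set.forall_mem_image.mpr hge)⟩

lemma tendsto_sSup_image_of_tendstoUniformlyOn {κ : Type*} {l : Filter κ} {F : κ → T → ℝ}
    (hne : S.Nonempty) (hα : BddAbove (α '' S)) (h : TendstoUniformlyOn F α l S) :
    Tendsto (fun N => sSup (F N '' S)) l (𝓝 (sSup (α '' S))) := by
  refine Metric.tendsto_nhds.mpr fun τ hτ => ?_
  filter_upwards [tendstoUniformlyOn_iff_forall_abs_sub_le.mp h (τ / 2) (half_pos hτ)] with N hN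
  exact (abs_sSup_image_sub_le hne hα hN).trans_lt (half_lt_self hτ)

variable [PseudoMetricSpace T]

/-- The maximum of `α` over the points of `S` at distance at least `δ` from the maximizers falls
short of the global maximum, and a function uniformly within a third of that gap of `α` cannot be
maximal there. -/
lemma exists_infDist_maximizers_le (hS : IsCompact S) (hα : ContinuousOn α S) {δ : ℝ}
    (hδ : 0 < δ) :
    ∃ τ : ℝ, 0 < τ ∧ ∀ F : T → ℝ, (∀ x ∈ S, |F x - α x| ≤ τ) →
      ∀ x ∈ maximizers F S, Metric.infDist x (maximizers α S) ≤ δ := by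
  rcases (S ∩ {x | δ ≤ Metric.infDist x (maximizers α S)}).eq_empty_or_nonempty with
    hempty | hfar
  · refine ⟨1, one_pos, fun F _ x hx => ?_⟩
    by_contra! hlt
    exact Set.notMem_empty x (hempty ▸ ⟨hx.1, hlt.le⟩)
  have hcompact : IsCompact (S ∩ {x | δ ≤ Metric.infDist x (maximizers α S)}) :=
    hS.inter_right (isClosed_le continuous_const (Metric.continuous_infDist_pt _))
  obtain ⟨y, ⟨hyS, hyδ⟩, hymax⟩ := hcompact.exists_isMaxOn hfar (hα.mono Set.inter_subset_left)
  obtain ⟨x₀, hx₀, hgap⟩ : ∃ x₀ ∈ S, α y < α x₀ := by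
    by_contra! hle
    have hy : y ∈ maximizers α S := ⟨hyS, hle⟩
    exact (hδ.trans_le hyδ).ne' (Metric.infDist_zero_of_mem hy)
  refine ⟨(α x₀ - α y) / 3, by linarith, fun F hF x hx => ?_⟩
  by_contra! hxδ
  have hαx : α x ≤ α y := hymax ⟨hx.1, hxδ.le⟩
  have hFx : F x₀ ≤ F x := hx.2 hx₀
  linarith [(abs_le.mp (hF x hx.1)).2, (abs_le.mp (hF x₀ hx₀)).1]

lemma tendsto_infDist_maximizers_of_tendstoUniformlyOn {κ : Type*} {l : Filter κ}
    {F : κ → T → ℝ} (hS : IsCompact S) (hα : ContinuousOn α S) (h : TendstoUniformlyOn F α l S)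
    {xhat : κ → T} (hxhat : ∀ᶠ N in l, xhat N ∈ maximizers (F N) S) :
    Tendsto (fun N => Metric.infDist (xhat N) (maximizers α S)) l (𝓝 0) := by
  refine Metric.tendsto_nhds.mpr fun δ hδ => ?_
  obtain ⟨τ, hτ, hdist⟩ := exists_infDist_maximizers_le hS hα (half_pos hδ)
  filter_upwards [tendstoUniformlyOn_iff_forall_abs_sub_le.mp h τ hτ, hxhat] with N hN hxN
  rw [Real.dist_0_eq_abs, abs_of_nonneg Metric.infDist_nonneg]
  exact (hdist (F N) hN _ hxN).trans_lt (half_lt_self hδ)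

lemma ExpTendstoUniformlyOn.expUnlikely_infDist_maximizers {Ω : Type*} [MeasurableSpace Ω]
    {P : Measure Ω} {F : ℕ → Ω → T → ℝ} (h : ExpTendstoUniformlyOn P F α S) (hS : IsCompact S)
    (hα : ContinuousOn α S) {δ : ℝ} (hδ : 0 < δ) :
    ExpUnlikely P fun N =>
      {ω | ∃ x ∈ maximizers (F N ω) S, δ < Metric.infDist x (maximizers α S)} := by
  obtain ⟨τ, hτ, hdist⟩ := exists_infDist_maximizers_le hS hα hδ
  refine (h τ hτ).mono fun N _ ω => ?_
  contrapose
  simp only [Set.mem_ofPred_eq, not_exists, not_and, not_lt]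
  exact hdist (F N ω)

end Argmax

section Subexponential

variable {E : Type*} [MeasurableSpace E] {ν : Measure E} {Y Z : E → ℝ}

/-- Subexponential random variables: those whose moment generating function is finite near `0`,
which is the condition under which sample means satisfy Cramér's large deviation bound. -/
def IsSubexponential (Y : E → ℝ) (ν : Measure E) : Prop :=
  ∀ᶠ t in 𝓝 (0 : ℝ), Integrable (fun e => Real.exp (t * Y e)) ν

namespace IsSubexponential

lemma zero_mem_interior (hY : IsSubexponential Y ν) : 0 ∈ interior (integrableExpSet Y ν) :=
  mem_interior_iff_mem_nhds.mpr hY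

lemma aemeasurable (hY : IsSubexponential Y ν) : AEMeasurable Y ν :=
  aemeasurable_of_mem_interior_integrableExpSet hY.zero_mem_interior

lemma integrable (hY : IsSubexponential Y ν) : Integrable Y ν :=
  memLp_one_iff_integrable.mp <| by
    simpa using memLp_of_mem_interior_integrableExpSet hY.zero_mem_interior 1

lemma neg (hY : IsSubexponential Y ν) : IsSubexponential (fun e => -Y e) ν := by
  have hneg : Tendsto Neg.neg (𝓝 (0 : ℝ)) (𝓝 0) := by simpa using tendsto_neg (0 : ℝ)
  filter_upwards [hneg.eventually hY] with t ht
  simpa using ht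

lemma add_const (hY : IsSubexponential Y ν) (c : ℝ) : IsSubexponential (fun e => Y e + c) ν := by
  filter_upwards [hY] with t ht
  simpa [mul_add, Real.exp_add] using ht.mul_const (Real.exp (t * c))

lemma mono (hY : IsSubexponential Y ν) (hZ : AEMeasurable Z ν) (h : ∀ e, |Z e| ≤ Y e) :
    IsSubexponential Z ν := by
  have habs : Tendsto abs (𝓝 (0 : ℝ)) (𝓝 0) := continuous_abs.tendsto' 0 0 abs_zero
  filter_upwards [habs.eventually hY] with t ht
  refine ht.mono (by fun_prop) (ae_of_all _ fun e => ?_)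
  simp only [Real.norm_eq_abs, Real.abs_exp, Real.exp_le_exp]
  calc t * Z e ≤ |t * Z e| := le_abs_self _
    _ = |t| * |Z e| := abs_mul _ _
    _ ≤ |t| * Y e := by gcongr; exact h e

/-- The moment generating function is `1` at `0`, with the mean as its derivative there. -/
lemma exists_mgf_lt_one [IsProbabilityMeasure ν] (hY : IsSubexponential Y ν)
    (hmean : ∫ e, Y e ∂ν < 0) :
    ∃ t : ℝ, 0 < t ∧ Integrable (fun e => Real.exp (t * Y e)) ν ∧ mgf Y ν t < 1 := by
  have hderiv : HasDerivAt (mgf Y ν) (∫ e, Y e ∂ν) 0 := by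
    simpa using hasDerivAt_mgf hY.zero_mem_interior
  have hslope : Tendsto (slope (mgf Y ν) 0) (𝓝[>] 0) (𝓝 (∫ e, Y e ∂ν)) :=
    (hasDerivAt_iff_tendsto_slope.mp hderiv).mono_left (nhdsGT_le_nhdsNE 0)
  obtain ⟨t, ⟨hneg, hint⟩, htpos⟩ := (((hslope.eventually_lt_const hmean).and
    (hY.filter_mono nhdsWithin_le_nhds)).and self_mem_nhdsWithin).exists
  have ht : 0 < t := htpos
  refine ⟨t, ht, hint, ?_⟩
  rw [slope_def_field, mgf_zero, sub_zero, div_lt_iff₀ ht] at hneg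
  linarith

end IsSubexponential

end Subexponential

section LargeDeviations

variable {E Ω Θ : Type*}

/-- The average of `Y` over the first `N` sample points; it is `0` for `N = 0`. -/
noncomputable def sampleMean (Y : E → ℝ) (e : ℕ → E) (N : ℕ) : ℝ :=
  (N : ℝ)⁻¹ * ∑ i ∈ Finset.range N, Y (e i)

lemma abs_sampleMean_sub_le {Y Z G : E → ℝ} {c : ℝ} (h : ∀ e, |Y e - Z e| ≤ c * G e)
    (e : ℕ → E) (N : ℕ) : |sampleMean Y e N - sampleMean Z e N| ≤ c * sampleMean G e N := by
  simp only [sampleMean]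
  rw [← mul_sub, ← Finset.sum_sub_distrib, abs_mul, abs_of_nonneg (by positivity),
    mul_left_comm, Finset.mul_sum]
  gcongr
  exact (Finset.abs_sum_le_sum_abs _ _).trans (Finset.sum_le_sum fun i _ => h (e i))

variable [MeasurableSpace E] {ν : Measure E}

lemma abs_integral_sub_integral_le {Y Z G : E → ℝ} {c : ℝ} (hY : Integrable Y ν)
    (hZ : Integrable Z ν) (hG : Integrable G ν) (h : ∀ e, |Y e - Z e| ≤ c * G e) :
    |∫ e, Y e ∂ν - ∫ e, Z e ∂ν| ≤ c * ∫ e, G e ∂ν := by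
  rw [← integral_sub hY hZ, ← integral_const_mul]
  exact norm_integral_le_of_norm_le (hG.const_mul c) <|
    ae_of_all _ fun e => (Real.norm_eq_abs _).trans_le (h e)

variable [MeasurableSpace Ω] {P : Measure Ω} {ε : ℕ → Ω → E} {Y : E → ℝ}

lemma mgf_sum_range_comp (hlaw : ∀ i, HasLaw (ε i) ν P) (hindep : iIndepFun ε P)
    (hY : AEMeasurable Y ν) (t : ℝ) (N : ℕ) :
    mgf (∑ i ∈ Finset.range N, Y ∘ ε i) P t = mgf Y ν t ^ N := by
  have hYlaw (i : ℕ) : AEMeasurable Y (P.map (ε i)) := (hlaw i).map_eq ▸ hY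
  have hmgf (i : ℕ) : mgf (Y ∘ ε i) P t = mgf Y ν t :=
    (hlaw i).integral_comp (f := fun e => Real.exp (t * Y e)) (by fun_prop)
  rw [(hindep.comp₀ (fun _ => Y) (fun i => (hlaw i).aemeasurable) hYlaw).mgf_sum₀
    fun i => (hYlaw i).comp_aemeasurable (hlaw i).aemeasurable]
  simp only [hmgf, Finset.prod_const, Finset.card_range]

lemma expUnlikely_sum_nonneg [IsProbabilityMeasure ν] (hlaw : ∀ i, HasLaw (ε i) ν P)
    (hindep : iIndepFun ε P) (hY : IsSubexponential Y ν) (hmean : ∫ e, Y e ∂ν < 0) :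
    ExpUnlikely P fun N => {ω | 0 ≤ ∑ i ∈ Finset.range N, Y (ε i ω)} := by
  have : IsProbabilityMeasure P := hindep.isProbabilityMeasure
  obtain ⟨t, ht, hint, hlt⟩ := hY.exists_mgf_lt_one hmean
  have hpos : 0 < mgf Y ν t := mgf_pos hint
  refine ⟨1, -Real.log (mgf Y ν t), neg_pos.mpr (Real.log_neg hpos hlt), fun N _ => ?_⟩
  have hmgf := mgf_sum_range_comp hlaw hindep hY.aemeasurable t N
  have hsum : Integrable
      (fun ω => Real.exp (t * (∑ i ∈ Finset.range N, Y ∘ ε i) ω)) P :=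
    mgf_pos_iff.mp (hmgf ▸ pow_pos hpos N)
  have hchernoff := measure_ge_le_exp_mul_mgf 0 ht.le hsum
  rw [hmgf] at hchernoff
  rw [← ofReal_measureReal, neg_neg, mul_comm (Real.log _), Real.exp_nat_mul, Real.exp_log hpos]
  exact ENNReal.ofReal_le_ofReal (by simpa using hchernoff)

lemma expUnlikely_abs_sampleMean_sub_integral [IsProbabilityMeasure ν]
    (hlaw : ∀ i, HasLaw (ε i) ν P) (hindep : iIndepFun ε P) (hY : IsSubexponential Y ν) {τ : ℝ}
    (hτ : 0 < τ) :
    ExpUnlikely P fun N => {ω | τ < |sampleMean Y (fun i => ε i ω) N - ∫ e, Y e ∂ν|} := by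
  have hupper := expUnlikely_sum_nonneg hlaw hindep (hY.add_const (-(∫ e, Y e ∂ν) - τ)) <| by
    rw [integral_add hY.integrable (integrable_const _), integral_const, probReal_univ, one_smul]
    linarith
  have hlower := expUnlikely_sum_nonneg hlaw hindep (hY.neg.add_const ((∫ e, Y e ∂ν) - τ)) <| by
    rw [integral_add hY.neg.integrable (integrable_const _), integral_neg, integral_const,
      probReal_univ, one_smul]
    linarith
  refine (hupper.union hlower).mono fun N hN ω hω => ?_
  have hN0 : (0 : ℝ) < N := by exact_mod_cast hN
  simp only [Set.mem_union, Set.mem_ofPred_eq, Finset.sum_add_distrib, Finset.sum_neg_distrib,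
    Finset.sum_const, Finset.card_range, nsmul_eq_mul]
  have hdev : τ < |sampleMean Y (fun i => ε i ω) N - ∫ e, Y e ∂ν| := hω
  rcases lt_abs.mp hdev with h | h
  · left
    rw [sampleMean, lt_sub_iff_add_lt, lt_inv_mul_iff₀ hN0] at h
    linarith
  · right
    rw [sampleMean, neg_sub, lt_sub_comm, inv_mul_lt_iff₀ hN0] at h
    linarith

/-- A deviation at `θ` forces one a third as large at a nearby point of a finite net, unless the
sample mean of the Lipschitz constant `G` is large. -/
lemma expTendstoUniformlyOn_sampleMean [IsProbabilityMeasure ν] (hlaw : ∀ i, HasLaw (ε i) ν P)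
    (hindep : iIndepFun ε P) [PseudoMetricSpace Θ] {S : Set Θ} (hS : TotallyBounded S)
    {h : Θ → E → ℝ} {G : E → ℝ} (hh : ∀ θ ∈ S, IsSubexponential (h θ) ν)
    (hG : IsSubexponential G ν)
    (hLip : ∀ θ ∈ S, ∀ θ' ∈ S, ∀ e, |h θ e - h θ' e| ≤ dist θ θ' * G e) :
    ExpTendstoUniformlyOn P (fun N ω θ => sampleMean (h θ) (fun i => ε i ω) N)
      (fun θ => ∫ e, h θ e ∂ν) S := by
  intro τ hτ
  set M : ℝ := |∫ e, G e ∂ν| + 1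
  have hM : 0 < M := by positivity
  obtain ⟨T, hTS, hTfin, hTcover⟩ :=
    Metric.finite_approx_of_totallyBounded hS (τ / (3 * M)) (by positivity)
  have hunlikely := (expUnlikely_abs_sampleMean_sub_integral hlaw hindep hG one_pos).union
    (.biUnion hTfin fun θ hθ =>
      expUnlikely_abs_sampleMean_sub_integral hlaw hindep (hh θ (hTS hθ)) (div_pos hτ three_pos))
  refine hunlikely.mono fun N _ ω => ?_
  contrapose
  simp only [Set.mem_union, Set.mem_iUnion, Set.mem_ofPred_eq, not_or, not_exists, not_and, not_lt]
  rintro ⟨hGdev, hTdev⟩ θ hθ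
  obtain ⟨θ', hθ', hdist⟩ := Set.mem_iUnion₂.mp (hTcover hθ)
  have hclose : dist θ θ' * M ≤ τ / 3 := by
    rw [← le_div_iff₀ hM, div_div]
    exact (Metric.mem_ball.mp hdist).le
  have hGint : ∫ e, G e ∂ν ≤ M := by linarith [le_abs_self (∫ e, G e ∂ν)]
  have hGmean : sampleMean G (fun i => ε i ω) N ≤ M := by
    linarith [(abs_le.mp hGdev).2, le_abs_self (∫ e, G e ∂ν)]
  have hsample : |sampleMean (h θ) (fun i => ε i ω) N - sampleMean (h θ') (fun i => ε i ω) N| ≤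
      τ / 3 :=
    (abs_sampleMean_sub_le (hLip θ hθ θ' (hTS hθ')) _ N).trans <|
      (mul_le_mul_of_nonneg_left hGmean dist_nonneg).trans hclose
  have hintegral : |∫ e, h θ e ∂ν - ∫ e, h θ' e ∂ν| ≤ τ / 3 :=
    (abs_integral_sub_integral_le (hh θ hθ).integrable (hh θ' (hTS hθ')).integrable hG.integrable
      (hLip θ hθ θ' (hTS hθ'))).trans <|
      (mul_le_mul_of_nonneg_left hGint dist_nonneg).trans hclose
  have hnet := abs_le.mp (hTdev θ' hθ')
  rw [abs_le] at hsample hintegral ⊢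
  constructor <;> linarith

end LargeDeviations

section Gaussian

variable {E : Type*} [NormedAddCommGroup E] [NormedSpace ℝ E] [MeasurableSpace E] [BorelSpace E]
  [SecondCountableTopology E] [CompleteSpace E]

lemma integrable_exp_mul_norm (ν : Measure E) [IsGaussian ν] (t : ℝ) :
    Integrable (fun e => Real.exp (t * ‖e‖)) ν := by
  obtain ⟨C, hC, hint⟩ := IsGaussian.exists_integrable_exp_sq ν
  refine (hint.const_mul (Real.exp (t ^ 2 / (4 * C)))).mono (by fun_prop) (ae_of_all _ fun e => ?_)
  simp only [Real.norm_eq_abs, Real.abs_exp, ← Real.exp_add, Real.exp_le_exp]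
  have hsq : 0 ≤ (t - 2 * C * ‖e‖) ^ 2 / (4 * C) := by positivity
  have hexpand : (t - 2 * C * ‖e‖) ^ 2 / (4 * C) =
      t ^ 2 / (4 * C) + C * ‖e‖ ^ 2 - t * ‖e‖ := by
    field_simp
    ring
  linarith

lemma isSubexponential_of_lipschitzWith {u : E → ℝ} {C : NNReal} (hu : LipschitzWith C u)
    (ν : Measure E) [IsGaussian ν] : IsSubexponential u ν := by
  have hnorm : IsSubexponential (fun e => C * ‖e‖) ν := .of_forall fun t => by
    simpa only [mul_assoc] using integrable_exp_mul_norm ν (t * C)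
  refine (hnorm.add_const |u 0|).mono hu.continuous.aemeasurable fun e => ?_
  have hdist : |u e - u 0| ≤ C * ‖e‖ := by
    simpa [Real.dist_eq] using hu.dist_le_mul e 0
  linarith [abs_sub_abs_le_abs_sub (u e) (u 0)]

end Gaussian

section AffineFamily

lemma lipschitzWith_mul_one_add_norm {E : Type*} [SeminormedAddCommGroup E] (C : NNReal) :
    LipschitzWith C fun e : E => (C : ℝ) * (1 + ‖e‖) :=
  LipschitzWith.of_dist_le_mul fun e e' => by
    rw [Real.dist_eq, ← mul_sub, add_sub_add_left_eq_sub, abs_mul, NNReal.abs_eq, dist_eq_norm]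
    gcongr
    exact abs_norm_sub_norm_le e e'

variable {E F : Type*} [NormedAddCommGroup E] [NormedSpace ℝ E] [NormedAddCommGroup F]
  [NormedSpace ℝ F] {u : F → ℝ} {C : NNReal}

lemma abs_comp_affine_sub_le (hu : LipschitzWith C u) (θ θ' : F × (E →L[ℝ] F)) (e : E) :
    |u (θ.1 + θ.2 e) - u (θ'.1 + θ'.2 e)| ≤ dist θ θ' * (C * (1 + ‖e‖)) := by
  have hfst : ‖θ.1 - θ'.1‖ ≤ dist θ θ' := by rw [dist_eq_norm]; exact norm_fst_le (θ - θ')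
  have hsnd : ‖θ.2 - θ'.2‖ ≤ dist θ θ' := by rw [dist_eq_norm]; exact norm_snd_le (θ - θ')
  calc |u (θ.1 + θ.2 e) - u (θ'.1 + θ'.2 e)|
      ≤ C * ‖(θ.1 + θ.2 e) - (θ'.1 + θ'.2 e)‖ := by
        rw [← Real.dist_eq, ← dist_eq_norm]; exact hu.dist_le_mul _ _
    _ = C * ‖(θ.1 - θ'.1) + (θ.2 - θ'.2) e‖ := by rw [sub_apply, add_sub_add_comm]
    _ ≤ C * (dist θ θ' + dist θ θ' * ‖e‖) := by
        gcongr
        exact (norm_add_le _ _).trans (add_le_add hfst ((θ.2 - θ'.2).le_of_opNorm_le hsnd e))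
    _ = dist θ θ' * (C * (1 + ‖e‖)) := by ring

lemma exists_lipschitzWith_sampleMean_comp_affine (hu : LipschitzWith C u) (e : ℕ → E) (N : ℕ) :
    ∃ K, LipschitzWith K fun θ : F × (E →L[ℝ] F) =>
      sampleMean (fun e => u (θ.1 + θ.2 e)) e N :=
  ⟨_, LipschitzWith.of_dist_le' fun θ θ' => by
    rw [Real.dist_eq, mul_comm]
    exact abs_sampleMean_sub_le (abs_comp_affine_sub_le hu θ θ') e N⟩

variable [MeasurableSpace E] [BorelSpace E] [SecondCountableTopology E] [CompleteSpace E]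

lemma isSubexponential_comp_affine (hu : LipschitzWith C u) (ν : Measure E) [IsGaussian ν]
    (θ : F × (E →L[ℝ] F)) : IsSubexponential (fun e => u (θ.1 + θ.2 e)) ν :=
  isSubexponential_of_lipschitzWith
    (hu.comp ((IsometryEquiv.addLeft θ.1).isometry.lipschitz.comp θ.2.lipschitz)) ν

lemma continuous_integral_comp_affine (hu : LipschitzWith C u) (ν : Measure E) [IsGaussian ν] :
    Continuous fun θ : F × (E →L[ℝ] F) => ∫ e, u (θ.1 + θ.2 e) ∂ν := by
  refine (LipschitzWith.of_dist_le' (K := ∫ e, C * (1 + ‖e‖) ∂ν) fun θ θ' => ?_).continuous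
  rw [Real.dist_eq, mul_comm]
  exact abs_integral_sub_integral_le (isSubexponential_comp_affine hu ν θ).integrable
    (isSubexponential_comp_affine hu ν θ').integrable
    (isSubexponential_of_lipschitzWith (lipschitzWith_mul_one_add_norm C) ν).integrable
    (abs_comp_affine_sub_le hu θ θ')

end AffineFamily

section MultivariateGaussian

lemma posSemidef_mul_transpose {ι κ : Type*} [Finite ι] [Fintype κ] (A : Matrix ι κ ℝ) :
    (A * A.transpose).PosSemidef := by
  simpa using Matrix.posSemidef_self_mul_conjTranspose A

variable {ι : Type*} [Fintype ι] [DecidableEq ι]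

lemma continuous_toEuclideanCLM : Continuous (Matrix.toEuclideanCLM (n := ι) (𝕜 := ℝ)) :=
  LinearMap.continuous_of_finiteDimensional
    (Matrix.toEuclideanCLM (n := ι) (𝕜 := ℝ)).toAlgEquiv.toLinearMap

lemma toEuclideanCLM_mul_transpose (A : Matrix ι ι ℝ) :
    Matrix.toEuclideanCLM (𝕜 := ℝ) (A * A.transpose) =
      Matrix.toEuclideanCLM (𝕜 := ℝ) A * star (Matrix.toEuclideanCLM (𝕜 := ℝ) A) := by
  rw [map_mul, ← map_star, Matrix.star_eq_conjTranspose,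
    Matrix.conjTranspose_eq_transpose_of_trivial]

lemma isBounded_toEuclideanCLM_image_of_mul_transpose_mem {B : Set (Matrix ι ι ℝ)}
    (hB : IsCompact B) :
    Bornology.IsBounded (Matrix.toEuclideanCLM (𝕜 := ℝ) '' {A | A * A.transpose ∈ B}) := by
  obtain ⟨R, hR⟩ := hB.exists_bound_of_continuousOn continuous_toEuclideanCLM.continuousOn
  refine isBounded_iff_forall_norm_le.mpr ⟨√R, Set.forall_mem_image.mpr fun A hA => ?_⟩
  rw [← Real.sqrt_mul_self (norm_nonneg _), ← CStarRing.norm_self_mul_star,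
    ← toEuclideanCLM_mul_transpose]
  exact Real.sqrt_le_sqrt (hR _ hA)

lemma map_stdGaussian_eq_multivariateGaussian (c : EuclideanSpace ℝ ι) (A : Matrix ι ι ℝ) :
    (stdGaussian (EuclideanSpace ℝ ι)).map (fun e => c + Matrix.toEuclideanCLM (𝕜 := ℝ) A e) =
      multivariateGaussian c (A * A.transpose) := by
  have hmap : (stdGaussian (EuclideanSpace ℝ ι)).map
      (fun e => c + Matrix.toEuclideanCLM (𝕜 := ℝ) A e) =
        ((stdGaussian (EuclideanSpace ℝ ι)).map (Matrix.toEuclideanCLM (𝕜 := ℝ) A)).map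
          (fun z => c + z) :=
    (Measure.map_map (measurable_const_add c) (by fun_prop)).symm
  rw [hmap]
  refine IsGaussian.ext ?_ ?_
  · rw [← hmap, integral_map (by fun_prop) (by fun_prop)]
    simp only [id_eq, integral_id_multivariateGaussian]
    rw [integral_add (integrable_const _) (ContinuousLinearMap.integrable_comp _
      IsGaussian.integrable_fun_id), ContinuousLinearMap.integral_comp_comm _
      IsGaussian.integrable_fun_id, integral_id_stdGaussian]
    simp
  · ext x y
    rw [covarianceBilin_multivariateGaussian (posSemidef_mul_transpose A),
      covarianceBilin_map_const_add, covarianceBilin_map IsGaussian.memLp_two_id,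
      covarianceBilin_stdGaussian, innerSL_apply_apply, ContinuousLinearMap.adjoint_inner_left,
      ← ContinuousLinearMap.star_eq_adjoint, ← mul_apply_eq_comp,
      ← toEuclideanCLM_mul_transpose, Matrix.inner_toEuclideanCLM]

lemma integral_multivariateGaussian_mul_transpose {u : EuclideanSpace ℝ ι → ℝ}
    (hu : StronglyMeasurable u) (c : EuclideanSpace ℝ ι) (A : Matrix ι ι ℝ) :
    ∫ z, u z ∂(multivariateGaussian c (A * A.transpose)) =
      ∫ e, u (c + Matrix.toEuclideanCLM (𝕜 := ℝ) A e) ∂(stdGaussian (EuclideanSpace ℝ ι)) := by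
  rw [← map_stdGaussian_eq_multivariateGaussian,
    integral_map (by fun_prop) hu.aestronglyMeasurable]

open scoped Matrix.Norms.L2Operator MatrixOrder in
lemma continuousOn_matrix_sqrt :
    ContinuousOn (CFC.sqrt : Matrix ι ι ℝ → Matrix ι ι ℝ) {A | A.PosSemidef} := by
  simpa only [Matrix.nonneg_iff_posSemidef] using CFC.continuousOn_sqrt (A := Matrix ι ι ℝ)

open scoped MatrixOrder in
lemma continuousOn_integral_multivariateGaussian {u : EuclideanSpace ℝ ι → ℝ} {C : NNReal}
    (hu : LipschitzWith C u) :
    ContinuousOn (fun p : EuclideanSpace ℝ ι × Matrix ι ι ℝ =>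
      ∫ z, u z ∂(multivariateGaussian p.1 p.2)) {p | p.2.PosSemidef} := by
  have hroot : ContinuousOn (fun p : EuclideanSpace ℝ ι × Matrix ι ι ℝ =>
      (p.1, Matrix.toEuclideanCLM (𝕜 := ℝ) (CFC.sqrt p.2))) {p | p.2.PosSemidef} :=
    continuousOn_fst.prodMk (continuous_toEuclideanCLM.comp_continuousOn
      (continuousOn_matrix_sqrt.comp continuousOn_snd fun _ hp => hp))
  refine ((continuous_integral_comp_affine hu
    (stdGaussian (EuclideanSpace ℝ ι))).comp_continuousOn hroot).congr fun p _ => ?_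
  exact integral_map (by fun_prop) hu.continuous.aestronglyMeasurable

end MultivariateGaussian

section SampleAverageApproximation

variable {T : Type*} {S : Set T}

lemma maximizers_nonempty [TopologicalSpace T] {F : T → ℝ} (hS : IsCompact S) (hne : S.Nonempty)
    (hF : ContinuousOn F S) : (maximizers F S).Nonempty :=
  hS.exists_isMaxOn hne hF

variable {ι : Type*} [Fintype ι] [DecidableEq ι] {μ : T → EuclideanSpace ℝ ι}
  {V L : T → Matrix ι ι ℝ} {u : EuclideanSpace ℝ ι → ℝ} {C : NNReal}

lemma continuousOn_integral_multivariateGaussian_comp [TopologicalSpace T]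
    (hμ : ContinuousOn μ S) (hV : ContinuousOn V S) (hVpsd : ∀ x ∈ S, (V x).PosSemidef)
    (hu : LipschitzWith C u) :
    ContinuousOn (fun x => ∫ z, u z ∂(multivariateGaussian (μ x) (V x))) S :=
  (continuousOn_integral_multivariateGaussian hu).comp (hμ.prodMk hV) hVpsd

lemma isBounded_image_prodMk_toEuclideanCLM [TopologicalSpace T] (hS : IsCompact S)
    (hμ : ContinuousOn μ S) (hV : ContinuousOn V S)
    (hL : ∀ x ∈ S, L x * (L x).transpose = V x) :
    Bornology.IsBounded ((fun x => (μ x, Matrix.toEuclideanCLM (𝕜 := ℝ) (L x))) '' S) := by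
  refine ((hS.image_of_continuousOn hμ).isBounded.prod
    (isBounded_toEuclideanCLM_image_of_mul_transpose_mem (hS.image_of_continuousOn hV))).subset ?_
  rintro _ ⟨x, hx, rfl⟩
  exact ⟨Set.mem_image_of_mem μ hx, L x, ⟨x, hx, (hL x hx).symm⟩, rfl⟩

variable {Ω : Type*} [MeasurableSpace Ω] {P : Measure Ω} {ε : ℕ → Ω → EuclideanSpace ℝ ι}

lemma expTendstoUniformlyOn_sampleMean_multivariateGaussian
    (hbdd : Bornology.IsBounded ((fun x => (μ x, Matrix.toEuclideanCLM (𝕜 := ℝ) (L x))) '' S))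
    (hL : ∀ x ∈ S, L x * (L x).transpose = V x) (hu : LipschitzWith C u)
    (hlaw : ∀ i, HasLaw (ε i) (stdGaussian (EuclideanSpace ℝ ι)) P) (hindep : iIndepFun ε P) :
    ExpTendstoUniformlyOn P
      (fun N ω x => sampleMean (fun e => u (μ x + Matrix.toEuclideanCLM (𝕜 := ℝ) (L x) e))
        (fun i => ε i ω) N)
      (fun x => ∫ z, u z ∂(multivariateGaussian (μ x) (V x))) S := by
  have : ProperSpace (EuclideanSpace ℝ ι × (EuclideanSpace ℝ ι →L[ℝ] EuclideanSpace ℝ ι)) :=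
    FiniteDimensional.proper ℝ _
  have hθ := expTendstoUniformlyOn_sampleMean hlaw hindep
    (hbdd.isCompact_closure.totallyBounded.subset subset_closure)
    (fun θ _ => isSubexponential_comp_affine hu _ θ)
    (isSubexponential_of_lipschitzWith (lipschitzWith_mul_one_add_norm C) _)
    (fun θ _ θ' _ => abs_comp_affine_sub_le hu θ θ')
  refine fun τ hτ => (hθ τ hτ).mono fun N _ ω => ?_
  rintro ⟨x, hx, hdev⟩
  refine ⟨_, Set.mem_image_of_mem _ hx, ?_⟩
  simpa only [← hL x hx, integral_multivariateGaussian_mul_transpose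
    hu.continuous.stronglyMeasurable] using hdev

end SampleAverageApproximation

section Posterior

variable {Ω₀ : Type*} [MeasurableSpace Ω₀] {d m n q : ℕ} {X : Set (EuclideanSpace ℝ (Fin d))}
  {P₀ : Measure Ω₀} {f : EuclideanSpace ℝ (Fin d) → Fin m → Ω₀ → ℝ} {D : Dataset d m n}

lemma isCompact_candSet (hX : IsCompact X) (q : ℕ) : IsCompact (candSet X q) := by
  have hpreimage : candSet X q =
      PiLp.homeomorph 2 (fun _ : Fin q => EuclideanSpace ℝ (Fin d)) ⁻¹'
        Set.univ.pi fun _ => X := by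
    ext x
    simp [candSet, PiLp.homeomorph]
  rw [hpreimage, Homeomorph.isCompact_preimage]
  exact isCompact_univ_pi fun _ => hX

lemma candSet_nonempty (hX : X.Nonempty) (q : ℕ) : (candSet X q).Nonempty :=
  let ⟨x, hx⟩ := hX
  ⟨WithLp.toLp 2 fun _ => x, fun _ => hx⟩

lemma IsC1GPPrior.continuousOn_mean (hf : IsC1GPPrior X f P₀) (i : Fin m) :
    ContinuousOn (fun x => priorMean f P₀ x i) X :=
  (hf.contDiffOn_mean i).continuousOn

lemma IsC1GPPrior.continuousOn_cov (hf : IsC1GPPrior X f P₀) (i j : Fin m) :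
    ContinuousOn (fun p : EuclideanSpace ℝ (Fin d) × EuclideanSpace ℝ (Fin d) =>
      priorCov f P₀ p.1 i p.2 j) (X ×ˢ X) :=
  (hf.contDiffOn_cov i j).continuousOn

variable (hcov : ∀ i j, ContinuousOn (fun p : EuclideanSpace ℝ (Fin d) × EuclideanSpace ℝ (Fin d) =>
    priorCov f P₀ p.1 i p.2 j) (X ×ˢ X)) (hD : ∀ k, D.pt k ∈ X)

include hcov hD

lemma continuousOn_crossCov : ContinuousOn (crossCov f P₀ D : Cand d q → _) (candSet X q) :=
  continuousOn_pi.mpr fun p => continuousOn_pi.mpr fun r =>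
    (hcov p.2 r.2).comp (f := fun x : Cand d q => (x p.1, D.pt r.1))
      (by fun_prop) fun _ hx => ⟨hx p.1, hD r.1⟩

lemma continuousOn_postMean (hmean : ∀ i, ContinuousOn (fun x => priorMean f P₀ x i) X) :
    ContinuousOn (postMean f P₀ D : Cand d q → _) (candSet X q) := by
  have hcorrection : Continuous fun A : Matrix (Fin q × Fin m) (Fin n × Fin m) ℝ =>
      (A * (obsCov f P₀ D)⁻¹).mulVec (fun r => D.obs r - priorMean f P₀ (D.pt r.1) r.2) := by
    fun_prop
  refine (PiLp.continuous_toLp 2 _).comp_continuousOn (ContinuousOn.add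
    (continuousOn_pi.mpr fun p => ?_)
    (hcorrection.comp_continuousOn (continuousOn_crossCov hcov hD)))
  exact (hmean p.2).comp (f := fun x : Cand d q => x p.1)
    (by fun_prop) fun _ hx => hx p.1

lemma continuousOn_postCov :
    ContinuousOn (postCov f P₀ D : Cand d q → _) (candSet X q) := by
  have hcorrection : Continuous fun A : Matrix (Fin q × Fin m) (Fin n × Fin m) ℝ =>
      A * (obsCov f P₀ D)⁻¹ * A.transpose := by fun_prop
  refine ContinuousOn.sub (continuousOn_pi.mpr fun p => continuousOn_pi.mpr fun r => ?_)
    (hcorrection.comp_continuousOn (continuousOn_crossCov hcov hD))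
  exact (hcov p.2 r.2).comp (f := fun x : Cand d q => (x p.1, x r.1))
    (by fun_prop) fun _ hx => ⟨hx p.1, hx r.1⟩

end Posterior

theorem theorem1_general {T : Type*} [PseudoMetricSpace T] {S : Set T} (hS : IsCompact S)
    (hne : S.Nonempty) {ι : Type*} [Fintype ι] [DecidableEq ι] {μ : T → EuclideanSpace ℝ ι}
    (hμ : ContinuousOn μ S) {V L : T → Matrix ι ι ℝ} (hV : ContinuousOn V S)
    (hL : ∀ x ∈ S, L x * (L x).transpose = V x) {u : EuclideanSpace ℝ ι → ℝ} {C : NNReal}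
    (hu : LipschitzWith C u) {Ω : Type*} [MeasurableSpace Ω] {P : Measure Ω}
    {ε : ℕ → Ω → EuclideanSpace ℝ ι}
    (hlaw : ∀ i, HasLaw (ε i) (stdGaussian (EuclideanSpace ℝ ι)) P) (hindep : iIndepFun ε P) :
    let α : T → ℝ := fun x => ∫ z, u z ∂(multivariateGaussian (μ x) (V x))
    let αhat : ℕ → Ω → T → ℝ := fun N ω x =>
      sampleMean (fun e => u (μ x + Matrix.toEuclideanCLM (𝕜 := ℝ) (L x) e)) (fun i => ε i ω) N
    (∀ x ∈ S, Integrable u (multivariateGaussian (μ x) (V x))) ∧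
    (maximizers α S).Nonempty ∧
    (∀ N ω, BddAbove (αhat N ω '' S)) ∧
    (ContinuousOn L S → ∀ N ω, (maximizers (αhat N ω) S).Nonempty) ∧
    (∀ᵐ ω ∂P, Tendsto (fun N => sSup (αhat N ω '' S)) atTop (𝓝 (sSup (α '' S)))) ∧
    (∀ᵐ ω ∂P, ∀ xhat : ℕ → T, (∀ N, 1 ≤ N → xhat N ∈ maximizers (αhat N ω) S) →
      Tendsto (fun N => Metric.infDist (xhat N) (maximizers α S)) atTop (𝓝 0)) ∧
    (∀ δ : ℝ, 0 < δ → ExpUnlikely P fun N =>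
      {ω | ∃ xhat ∈ maximizers (αhat N ω) S, δ < Metric.infDist xhat (maximizers α S)}) := by
  intro α αhat
  have hVpsd : ∀ x ∈ S, (V x).PosSemidef := fun x hx => hL x hx ▸ posSemidef_mul_transpose (L x)
  have hα : ContinuousOn α S := continuousOn_integral_multivariateGaussian_comp hμ hV hVpsd hu
  have hbdd := isBounded_image_prodMk_toEuclideanCLM hS hμ hV hL
  have hdev : ExpTendstoUniformlyOn P αhat α S :=
    expTendstoUniformlyOn_sampleMean_multivariateGaussian hbdd hL hu hlaw hindep
  refine ⟨fun x _ => (isSubexponential_of_lipschitzWith hu _).integrable,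
    maximizers_nonempty hS hne hα, fun N ω => ?_, fun hLc N ω => ?_, ?_, ?_,
    fun δ hδ => hdev.expUnlikely_infDist_maximizers hS hα hδ⟩
  · obtain ⟨K, hK⟩ := exists_lipschitzWith_sampleMean_comp_affine hu (fun i => ε i ω) N
    simpa only [Set.image_image] using (hK.isBounded_image hbdd).bddAbove
  · obtain ⟨K, hK⟩ := exists_lipschitzWith_sampleMean_comp_affine hu (fun i => ε i ω) N
    have hθ : ContinuousOn (fun x => (μ x, Matrix.toEuclideanCLM (𝕜 := ℝ) (L x))) S :=
      hμ.prodMk (continuous_toEuclideanCLM.comp_continuousOn hLc)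
    have hαhat := hK.continuous.comp_continuousOn hθ
    exact maximizers_nonempty hS hne hαhat
  · filter_upwards [hdev.ae_tendstoUniformlyOn] with ω hω
    exact tendsto_sSup_image_of_tendstoUniformlyOn hne (hS.image_of_continuousOn hα).bddAbove hω
  · filter_upwards [hdev.ae_tendstoUniformlyOn] with ω hω xhat hxhat
    exact tendsto_infDist_maximizers_of_tendstoUniformlyOn hS hα hω
      ((eventually_ge_atTop 1).mono hxhat)

theorem theorem1
    {d m n q : ℕ}
    -- compact design space
    (X : Set (EuclideanSpace ℝ (Fin d))) (hXc : IsCompact X) (hXne : X.Nonempty)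
    -- Gaussian process prior with continuously differentiable mean and covariance functions
    {Ω₀ : Type*} [MeasurableSpace Ω₀] (P₀ : Measure Ω₀) [IsProbabilityMeasure P₀]
    (f : EuclideanSpace ℝ (Fin d) → Fin m → Ω₀ → ℝ) (hf : IsC1GPPrior X f P₀)
    -- the data, for which the Gaussian conditioning formulas make sense
    (D : Dataset d m n) (hDX : ∀ k, D.pt k ∈ X) (hDnoise : D.noiseCov.PosSemidef)
    (hDinv : IsUnit (obsCov f P₀ D).det)
    -- Lipschitz objective and utility functions
    (g : EuclideanSpace ℝ (Fin q × Fin m) → EuclideanSpace ℝ (Fin q))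
    (hg : ∃ C, LipschitzWith C g)
    {Par : Type*} (a : EuclideanSpace ℝ (Fin q) → Par → ℝ) (φ : Par)
    (ha : ∃ C, LipschitzWith C (fun v => a v φ))
    -- a root decomposition (e.g. Cholesky) of the posterior covariance
    (L : Cand d q → Matrix (Fin q × Fin m) (Fin q × Fin m) ℝ)
    (hL : ∀ x ∈ candSet X q, L x * (L x).transpose = postCov f P₀ D x)
    -- i.i.d. standard normal base samples
    {Ω : Type*} [MeasurableSpace Ω] (P : Measure Ω) [IsProbabilityMeasure P]
    (ε : ℕ → Ω → EuclideanSpace ℝ (Fin q × Fin m))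
    (hlaw : ∀ i, HasLaw (ε i) (stdGaussian (EuclideanSpace ℝ (Fin q × Fin m))) P)
    (hindep : iIndepFun ε P) :
    let u : EuclideanSpace ℝ (Fin q × Fin m) → ℝ := fun z => a (g z) φ
    let α : Cand d q → ℝ := acq f P₀ D u
    let αhat : ℕ → Ω → Cand d q → ℝ := fun N ω => saa f P₀ D L u (fun i => ε i ω) N
    let Xstar : Set (Cand d q) := maximizers α (candSet X q)
    -- the quantities in the claims are well defined
    (∀ x ∈ candSet X q, Integrable u (postLaw f P₀ D x)) ∧
    Xstar.Nonempty ∧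
    (∀ N ω, BddAbove (αhat N ω '' candSet X q)) ∧
    (ContinuousOn L (candSet X q) →
      ∀ N ω, (maximizers (αhat N ω) (candSet X q)).Nonempty) ∧
    -- (1) convergence of the optimal values
    (∀ᵐ ω ∂P, Tendsto (fun N => sSup (αhat N ω '' candSet X q)) atTop
      (𝓝 (sSup (α '' candSet X q)))) ∧
    -- (2) convergence of every sequence of optimizers to the set of true optimizers
    (∀ᵐ ω ∂P, ∀ xhat : ℕ → Cand d q,
      (∀ N, 1 ≤ N → xhat N ∈ maximizers (αhat N ω) (candSet X q)) →
      Tendsto (fun N => Metric.infDist (xhat N) Xstar) atTop (𝓝 0)) ∧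
    -- (3) exponential rate, uniformly over the choice of the optimizer
    (∀ δ : ℝ, 0 < δ → ∃ K β : ℝ, 0 < β ∧ ∀ N : ℕ, 1 ≤ N →
      P {ω | ∃ xhat ∈ maximizers (αhat N ω) (candSet X q), δ < Metric.infDist xhat Xstar} ≤
        ENNReal.ofReal (K * Real.exp (-β * N))) := by
  obtain ⟨Cg, hCg⟩ := hg
  obtain ⟨Ca, hCa⟩ := ha
  exact theorem1_general (isCompact_candSet hXc q) (candSet_nonempty hXne q)
    (continuousOn_postMean hf.continuousOn_cov hDX hf.continuousOn_mean)
    (continuousOn_postCov hf.continuousOn_cov hDX) hL (hCa.comp hCg) hlaw hindep
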